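/- Let $L$ be a finite lattice with minimum $\hat 0$, maximum $\hat 1$ and Möbius function $\mu$, and let $\Delta:\hat 0=x_0\prec x_1\prec\cdots\prec x_n=\hat 1$ be a maximal chain of $L$. For $1\le i\le n$ let the $i$-th level $A_i$ be the set of atoms $a$ of $L$ with $a\le x_i$ and $a\not\le x_{i-1}$, and for atoms $a,b$ write $a\lhd b$ if $a\in A_i$ and $b\in A_j$ for some $i<j$. Suppose that $(L,\Delta)$ is an LL lattice, that is: (1) every $x_i$ is left-modular: $z\vee(x_i\wedge y)=(z\vee x_i)\wedge y$ for all $y,z\in L$ with $z<y$; (2) the level condition holds: if $a\lhd b_1\lhd b_2\lhd\cdots\lhd b_k$ with $k\ge 1$, then $a\not\le b_1\vee b_2\vee\cdots\vee b_k$. For $y\in L$ let $\rho(y)$ be the number of levels $A_i$ that contain an atom $a\le y$, and let $$\chi(L,t)=\sum_{y\in L}\mu(\hat 0,y)\,t^{\rho(\hat 1)-\rho(y)}$$ be the characteristic polynomial of $L$ with respect to the generalized rank function $\rho$. Then $$\chi(L,t)=\prod_{i\,:\,A_i\ne\emptyset}\bigl(t-|A_i|\bigr).$$ -/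

import Mathlib

open Polynomial

/-- `(x, y)` is a modular pair: the modular inequality is an equality for every `z < y`. -/
def IsModularPair {L : Type*} [Lattice L] (x y : L) : Prop :=
  ∀ z : L, z < y → z ⊔ (x ⊓ y) = (z ⊔ x) ⊓ y

/-- `x` is left-modular: `(x, y)` is a modular pair for every `y`. -/
def IsLeftModularElement {L : Type*} [Lattice L] (x : L) : Prop :=
  ∀ y : L, IsModularPair x y

/-- `x 0 ⋖ x 1 ⋖ ⋯ ⋖ x n` is a maximal chain from `⊥` to `⊤`. -/
structure IsSaturatedMaximalChain {L : Type*} [Lattice L] [BoundedOrder L] {n : ℕ}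
    (x : Fin (n + 1) → L) : Prop where
  bot : x 0 = ⊥
  top : x (Fin.last n) = ⊤
  covBy : ∀ i : Fin n, x i.castSucc ⋖ x i.succ

open scoped Classical in
/-- The levels of the set of atoms induced by the chain. The index `i : Fin n` (counted from `0`)
stands for the level of the atoms below `x (i + 1)` and not below `x i`. -/
noncomputable def atomLevel {L : Type*} [Lattice L] [BoundedOrder L] [Fintype L] {n : ℕ}
    (x : Fin (n + 1) → L) (i : Fin n) : Finset L :=
  Finset.univ.filter fun a => IsAtom a ∧ a ≤ x i.succ ∧ ¬ a ≤ x i.castSucc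

/-- `a` is an atom of a strictly lower level than the atom `b`. -/
def LevelLT {L : Type*} [Lattice L] [BoundedOrder L] [Fintype L] {n : ℕ}
    (x : Fin (n + 1) → L) (a b : L) : Prop :=
  ∃ i j : Fin n, i < j ∧ a ∈ atomLevel x i ∧ b ∈ atomLevel x j

/-- The level condition: if `a` is of lower level than `b 0`, which is of lower level than `b 1`,
and so on up to `b k`, then `a` is not below the join of the `b i`. -/
def LevelCondition {L : Type*} [Lattice L] [BoundedOrder L] [Fintype L] {n : ℕ}
    (x : Fin (n + 1) → L) : Prop :=
  ∀ (k : ℕ) (a : L) (b : Fin (k + 1) → L), LevelLT x a (b 0) →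
    (∀ i : Fin k, LevelLT x (b i.castSucc) (b i.succ)) → ¬ a ≤ Finset.univ.sup b

/-- `L` with the maximal chain `x` is an LL lattice: all elements of the chain are left-modular
and the level condition holds. -/
structure IsLLLattice {L : Type*} [Lattice L] [BoundedOrder L] [Fintype L] {n : ℕ}
    (x : Fin (n + 1) → L) : Prop where
  chain : IsSaturatedMaximalChain x
  leftModular : ∀ i : Fin (n + 1), IsLeftModularElement (x i)
  levelCondition : LevelCondition x

open scoped Classical in
/-- The generalized rank `ρ y`: the number of levels that contain an atom below `y`. -/
noncomputable def levelRank {L : Type*} [Lattice L] [BoundedOrder L] [Fintype L] {n : ℕ}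
    (x : Fin (n + 1) → L) (y : L) : ℕ :=
  (Finset.univ.filter fun i : Fin n => ∃ a ∈ atomLevel x i, a ≤ y).card

/-- The generalized rank is monotone, so the natural-number subtraction `ρ ⊤ - ρ y` is an honest
difference. -/
theorem levelRank_mono {L : Type*} [Lattice L] [BoundedOrder L] [Fintype L] {n : ℕ}
    (x : Fin (n + 1) → L) : Monotone (levelRank x) := by
  classical
  intro y z h
  unfold levelRank
  apply Finset.card_le_card
  intro i hi
  simp only [Finset.mem_filter, Finset.mem_univ, true_and] at hi ⊢
  obtain ⟨a, ha, hay⟩ := hi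
  exact ⟨a, ha, hay.trans h⟩

/-- The characteristic polynomial `∑ y, μ(⊥, y) t ^ (ρ ⊤ - ρ y)` with respect to a monotone
generalized rank function `ρ`; here `t` is the polynomial variable. -/
noncomputable def charPolynomial {L : Type*} [Lattice L] [BoundedOrder L] [Fintype L]
    [LocallyFiniteOrder L] [DecidableEq L] (ρ : L → ℕ) : ℤ[X] :=
  ∑ y : L, C (IncidenceAlgebra.mu ℤ (⊥ : L) y) * X ^ (ρ ⊤ - ρ y)

/-!
The proof expands both sides over *transversals* of the levels: families `g` choosing, for every
level, either one of its atoms or no atom. Encoding "no atom" by `⊥` makes the join of the chosen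
atoms equal to `Finset.univ.sup g`, and expanding `∏ i, (t - |A i|)` over the nonempty levels gives
`∑ g, (-1) ^ k * t ^ (N - k)`, where `k` is the number of atoms chosen by `g` and `N` is the number
of nonempty levels.

On the other side two facts are needed.

* `mu_bot_eq_sum_levelTransversals`: `μ(⊥, y)` is the sum of `(-1) ^ k` over the transversals with
  join `y`. By the recursion for `μ` it suffices to sum over the transversals with join at most `w`.
  That sum is the product over the levels of `1 - (number of atoms of the level below w)`. If
  `w ≠ ⊥`, the factor at the lowest level with an atom below `w` vanishes: for two distinct atoms
  `a`, `b` of one level, left-modularity yields an atom of strictly lower level below `a ⊔ b`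
  (`exists_atom_le_sup_of_mem_atomLevel`), so that level has exactly one atom below `w`.
* `levelRank_sup`: the join of a transversal has rank equal to the number of chosen atoms. For an
  atom `a` of level `i` below the join, let `u` be the join of the atoms chosen at higher levels.
  If no atom of level `i` is chosen, then `a` lies below `u ⊔ x i`, while the level condition gives
  `x i ⊓ (u ⊔ a) = ⊥`; left-modularity of `x i` then forces `a ≤ u`, against the level condition.
-/

/-! ### Levels of atoms -/

theorem IsSaturatedMaximalChain.monotone {L : Type*} [Lattice L] [BoundedOrder L] {n : ℕ}
    {x : Fin (n + 1) → L} (hx : IsSaturatedMaximalChain x) : Monotone x :=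
  Fin.monotone_iff_le_succ.2 fun i => (hx.covBy i).le

section

variable {L : Type*} [Lattice L] [BoundedOrder L] [Fintype L] {n : ℕ} {x : Fin (n + 1) → L}

theorem mem_atomLevel {i : Fin n} {a : L} :
    a ∈ atomLevel x i ↔ IsAtom a ∧ a ≤ x i.succ ∧ ¬ a ≤ x i.castSucc := by
  simp [atomLevel]

theorem bot_notMem_atomLevel (i : Fin n) : (⊥ : L) ∉ atomLevel x i :=
  fun h => (mem_atomLevel.1 h).1.1 rfl

/-- An atom below `x k` belongs to some level below the index `k`. -/
theorem IsSaturatedMaximalChain.exists_mem_atomLevel (hx : IsSaturatedMaximalChain x) {a : L}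
    (ha : IsAtom a) (k : Fin (n + 1)) (hak : a ≤ x k) :
    ∃ i : Fin n, i.castSucc < k ∧ a ∈ atomLevel x i := by
  induction k using Fin.induction with
  | zero => exact absurd (le_bot_iff.1 (hx.bot ▸ hak)) ha.1
  | succ i ih =>
    by_cases h : a ≤ x i.castSucc
    · obtain ⟨j, hj, hja⟩ := ih h
      exact ⟨j, hj.trans i.castSucc_lt_succ, hja⟩
    · exact ⟨i, i.castSucc_lt_succ, mem_atomLevel.2 ⟨ha, hak, h⟩⟩

theorem IsSaturatedMaximalChain.atomLevel_unique (hx : IsSaturatedMaximalChain x) {a : L}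
    {i j : Fin n} (hi : a ∈ atomLevel x i) (hj : a ∈ atomLevel x j) : i = j := by
  have key : ∀ {i j : Fin n}, a ∈ atomLevel x i → a ∈ atomLevel x j → ¬ i < j := fun hi hj h =>
    (mem_atomLevel.1 hj).2.2 ((mem_atomLevel.1 hi).2.1.trans
      (hx.monotone (Fin.succ_le_castSucc_iff.2 h)))
  exact le_antisymm (not_lt.1 (key hj hi)) (not_lt.1 (key hi hj))

/-- The join of two distinct atoms of the same level lies above an atom of strictly lower level. -/
theorem exists_atom_le_sup_of_mem_atomLevel (hx : IsSaturatedMaximalChain x) {i : Fin n}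
    (hm : IsLeftModularElement (x i.castSucc)) {a b : L} (ha : a ∈ atomLevel x i)
    (hb : b ∈ atomLevel x i) (hab : a ≠ b) :
    ∃ j < i, ∃ c ∈ atomLevel x j, c ≤ a ⊔ b := by
  obtain ⟨haa, ha1, ha2⟩ := mem_atomLevel.1 ha
  obtain ⟨hba, hb1, -⟩ := mem_atomLevel.1 hb
  have hlt : a < a ⊔ b := by
    refine lt_of_le_of_ne le_sup_left fun h => hab ?_
    have hle : b ≤ a := h ▸ le_sup_right
    exact ((haa.le_iff.1 hle).resolve_left hba.1).symm
  -- `x i` is covered by `x (i + 1)`, so joining `a` to it already gives `x (i + 1)`.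
  have hsup : a ⊔ x i.castSucc = x i.succ :=
    ((hx.covBy i).eq_or_eq le_sup_right (sup_le ha1 (hx.covBy i).le)).resolve_left
      fun h => ha2 (h ▸ le_sup_left)
  have hmod := hm (a ⊔ b) a hlt
  rw [hsup, inf_eq_right.2 (sup_le ha1 hb1)] at hmod
  have hne : x i.castSucc ⊓ (a ⊔ b) ≠ ⊥ := fun h => by
    rw [h, sup_bot_eq] at hmod
    exact hlt.ne hmod
  obtain ⟨c, hc, hcle⟩ := (eq_bot_or_exists_atom_le _).resolve_left hne
  obtain ⟨j, hj, hcj⟩ := hx.exists_mem_atomLevel hc _ (hcle.trans inf_le_left)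
  exact ⟨j, Fin.castSucc_lt_castSucc_iff.1 hj, c, hcj, hcle.trans inf_le_right⟩

/-! ### Transversals of the levels -/

open scoped Classical in
/-- The families choosing from each level at most one atom; the value `⊥` at an index means that
no atom of that level is chosen. -/
noncomputable def levelTransversals (x : Fin (n + 1) → L) : Finset (Fin n → L) :=
  Fintype.piFinset fun i => insert ⊥ (atomLevel x i)

theorem mem_levelTransversals {g : Fin n → L} :
    g ∈ levelTransversals x ↔ ∀ i, g i ≠ ⊥ → g i ∈ atomLevel x i := by
  simp [levelTransversals, or_iff_not_imp_left]

/-- The level condition for transversals: an atom is not below a join of atoms chosen at strictly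
higher levels. -/
theorem LevelCondition.not_le_sup (hx : LevelCondition x) {g : Fin n → L}
    (hg : g ∈ levelTransversals x) {i : Fin n} {a : L} (ha : a ∈ atomLevel x i)
    (hgi : ∀ j ≤ i, g j = ⊥) : ¬ a ≤ Finset.univ.sup g := by
  classical
  rw [mem_levelTransversals] at hg
  let S : Finset (Fin n) := Finset.univ.filter fun j => g j ≠ ⊥
  have hS : ∀ j, j ∈ S ↔ g j ≠ ⊥ := fun j => by simp [S]
  intro hle
  obtain hk | ⟨k, hk⟩ : S.card = 0 ∨ ∃ k, S.card = k + 1 := by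
    cases S.card <;> simp
  · refine (mem_atomLevel.1 ha).1.1 (le_bot_iff.1 (hle.trans (Finset.sup_le fun j _ => ?_)))
    by_contra hj
    have : j ∈ S := (hS j).2 fun h => hj h.le
    rw [Finset.card_eq_zero.1 hk] at this
    simp at this
  · let e := S.orderEmbOfFin hk
    have he : ∀ m, g (e m) ≠ ⊥ := fun m => (hS _).1 (S.orderEmbOfFin_mem hk m)
    refine hx k a (g ∘ e) ⟨i, e 0, ?_, ha, hg _ (he 0)⟩
      (fun m => ⟨e m.castSucc, e m.succ, e.strictMono m.castSucc_lt_succ, hg _ (he _),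
        hg _ (he _)⟩) (hle.trans (Finset.sup_le fun j _ => ?_))
    · by_contra h
      exact he 0 (hgi _ (not_lt.1 h))
    · by_cases hj : g j = ⊥
      · simp [hj]
      · obtain ⟨m, hm⟩ : j ∈ Set.range e := by
          rw [Finset.range_orderEmbOfFin]
          exact (hS j).2 hj
        rw [← hm]
        exact Finset.le_sup (f := g ∘ e) (Finset.mem_univ m)

/-- An atom below the join of a transversal belongs to a level from which an atom is chosen. -/
theorem IsLLLattice.ne_bot_of_le_sup (hL : IsLLLattice x) {g : Fin n → L}
    (hg : g ∈ levelTransversals x) {i : Fin n} {a : L} (ha : a ∈ atomLevel x i)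
    (hle : a ≤ Finset.univ.sup g) : g i ≠ ⊥ := by
  classical
  intro hgi
  have hg' := mem_levelTransversals.1 hg
  let h : Fin n → L := fun j => if i < j then g j else ⊥
  have hh : h ∈ levelTransversals x := mem_levelTransversals.2 fun j hj => by
    by_cases hij : i < j
    · simp only [h, hij, if_true] at hj ⊢
      exact hg' j hj
    · simp [h, hij] at hj
  have hh0 : ∀ j ≤ i, h j = ⊥ := fun j hj => by simp [h, not_lt.2 hj]
  set u := Finset.univ.sup h with hu
  have hnot : ¬ a ≤ u := hL.levelCondition.not_le_sup hh ha hh0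
  have hlt : u < u ⊔ a := left_lt_sup.2 hnot
  have hle' : a ≤ u ⊔ x i.castSucc := by
    refine hle.trans (Finset.sup_le fun j _ => ?_)
    by_cases hj : g j = ⊥
    · simp [hj]
    rcases lt_trichotomy i j with hij | rfl | hij
    · refine le_sup_of_le_left ?_
      have := Finset.le_sup (f := h) (Finset.mem_univ j)
      simpa only [h, hij, if_true] using this
    · exact absurd hgi hj
    · exact le_sup_of_le_right ((mem_atomLevel.1 (hg' j hj)).2.1.trans
        (hL.chain.monotone (Fin.succ_le_castSucc_iff.2 hij)))
  -- An atom below `x i` has level less than `i`, whereas `u ⊔ a` is the join of a transversal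
  -- supported on the levels from `i` on.
  have hbot : x i.castSucc ⊓ (u ⊔ a) = ⊥ := by
    by_contra hne
    obtain ⟨c, hc, hcle⟩ := (eq_bot_or_exists_atom_le _).resolve_left hne
    obtain ⟨j, hj, hcj⟩ := hL.chain.exists_mem_atomLevel hc _ (hcle.trans inf_le_left)
    have hji : j < i := Fin.castSucc_lt_castSucc_iff.1 hj
    refine hL.levelCondition.not_le_sup (g := Function.update h i a) ?_ hcj ?_
      ((hcle.trans inf_le_right).trans (sup_le (Finset.sup_le fun m _ => ?_) ?_))
    · refine mem_levelTransversals.2 fun m hm => ?_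
      by_cases hmi : m = i
      · subst hmi
        simpa using ha
      · simp only [Function.update_of_ne hmi] at hm ⊢
        exact mem_levelTransversals.1 hh m hm
    · intro m hm
      rw [Function.update_of_ne (hm.trans_lt hji).ne]
      exact hh0 m (hm.trans hji.le)
    · by_cases hmi : m = i
      · simp [hmi, hh0 i le_rfl]
      · have := Finset.le_sup (f := Function.update h i a) (Finset.mem_univ m)
        rwa [Function.update_of_ne hmi] at this
    · have := Finset.le_sup (f := Function.update h i a) (Finset.mem_univ i)
      rwa [Function.update_self] at this
  have hmod := hL.leftModular i.castSucc (u ⊔ a) u hlt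
  rw [hbot, sup_bot_eq, inf_eq_right.2 (sup_le le_sup_left hle')] at hmod
  exact hlt.ne hmod

open scoped Classical in
theorem IsLLLattice.levelRank_sup (hL : IsLLLattice x) {g : Fin n → L}
    (hg : g ∈ levelTransversals x) :
    levelRank x (Finset.univ.sup g) = (Finset.univ.filter fun i => g i ≠ ⊥).card := by
  unfold levelRank
  congr 1
  ext i
  simp only [Finset.mem_filter, Finset.mem_univ, true_and]
  constructor
  · rintro ⟨a, ha, hle⟩
    exact hL.ne_bot_of_le_sup hg ha hle
  · intro hi
    exact ⟨g i, mem_levelTransversals.1 hg i hi, Finset.le_sup (Finset.mem_univ i)⟩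

open scoped Classical in
/-- The generalized rank of `⊤` counts all nonempty levels, and each of them is either chosen from
by the transversal `g` or not. -/
theorem IsLLLattice.levelRank_top_sub (hL : IsLLLattice x) {g : Fin n → L}
    (hg : g ∈ levelTransversals x) :
    levelRank x ⊤ - levelRank x (Finset.univ.sup g) =
      (Finset.univ.filter fun i => (atomLevel x i).Nonempty ∧ g i = ⊥).card := by
  have htop : levelRank x ⊤ = (Finset.univ.filter fun i => (atomLevel x i).Nonempty).card := by
    unfold levelRank
    congr 1
    ext i
    simp only [Finset.mem_filter, Finset.mem_univ, true_and, le_top, and_true]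
    exact Iff.rfl
  rw [htop, hL.levelRank_sup hg, ← Finset.card_sdiff_of_subset]
  · congr 1
    ext i
    simp
  · intro i hi
    simp only [Finset.mem_filter, Finset.mem_univ, true_and] at hi ⊢
    exact ⟨_, mem_levelTransversals.1 hg i hi⟩

/-! ### The Möbius function -/

open scoped Classical in
/-- The signed count of the transversals with join at most `w`. -/
theorem IsLLLattice.sum_levelTransversals_le (hL : IsLLLattice x) (w : L) :
    ∑ g ∈ (levelTransversals x).filter (fun g => Finset.univ.sup g ≤ w),
      ∏ i, (if g i = ⊥ then (1 : ℤ) else -1) = if w = ⊥ then 1 else 0 := by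
  have hpi : (levelTransversals x).filter (fun g => Finset.univ.sup g ≤ w) =
      Fintype.piFinset fun i => insert ⊥ ((atomLevel x i).filter (· ≤ w)) := by
    ext g
    simp only [Finset.mem_filter, levelTransversals, Fintype.mem_piFinset, Finset.mem_insert,
      Finset.sup_le_iff, Finset.mem_univ, true_imp_iff, ← forall_and]
    refine forall_congr' fun i => ?_
    constructor
    · tauto
    · rintro (h | h)
      · simp [h]
      · tauto
  rw [hpi, ← Finset.prod_univ_sum (fun i => insert ⊥ ((atomLevel x i).filter (· ≤ w)))
    (fun _ a => if a = ⊥ then (1 : ℤ) else -1)]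
  have hfac : ∀ i, ∑ a ∈ insert ⊥ ((atomLevel x i).filter (· ≤ w)),
      (if a = ⊥ then (1 : ℤ) else -1) = 1 - ((atomLevel x i).filter (· ≤ w)).card := fun i => by
    have hneg : ∀ a ∈ (atomLevel x i).filter (· ≤ w), (if a = ⊥ then (1 : ℤ) else -1) = -1 :=
      fun a ha => if_neg (mem_atomLevel.1 (Finset.mem_filter.1 ha).1).1.1
    rw [Finset.sum_insert (fun h => bot_notMem_atomLevel i (Finset.mem_filter.1 h).1), if_pos rfl,
      Finset.sum_congr rfl hneg]
    simp [sub_eq_add_neg]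
  simp only [hfac]
  split_ifs with hw
  · subst hw
    refine Finset.prod_eq_one fun i _ => ?_
    rw [Finset.card_eq_zero.2 (Finset.filter_eq_empty_iff.2 fun a ha h =>
      (mem_atomLevel.1 ha).1.1 (le_bot_iff.1 h))]
    simp
  · obtain ⟨a, ha, haw⟩ := (eq_bot_or_exists_atom_le w).resolve_left hw
    obtain ⟨i₀, -, hi₀⟩ := hL.chain.exists_mem_atomLevel ha (Fin.last n)
      (hL.chain.top ▸ le_top)
    obtain ⟨i, ⟨b, hb, hbw⟩, hmin⟩ := wellFounded_lt.has_min
      {i : Fin n | ∃ a ∈ atomLevel x i, a ≤ w} ⟨i₀, a, hi₀, haw⟩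
    refine Finset.prod_eq_zero (Finset.mem_univ i) ?_
    rw [Finset.card_eq_one.2 ⟨b, ?_⟩]
    · simp
    · refine Finset.eq_singleton_iff_unique_mem.2 ⟨Finset.mem_filter.2 ⟨hb, hbw⟩, fun c hc => ?_⟩
      obtain ⟨hc, hcw⟩ := Finset.mem_filter.1 hc
      by_contra hcb
      obtain ⟨j, hj, d, hd, hdle⟩ :=
        exists_atom_le_sup_of_mem_atomLevel hL.chain (hL.leftModular _) hc hb hcb
      exact hmin j ⟨d, hd, hdle.trans (sup_le hcw hbw)⟩ hj

open scoped Classical in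
/-- The Möbius function counts, with signs, the transversals with a given join. -/
theorem IsLLLattice.mu_bot_eq_sum_levelTransversals [LocallyFiniteOrder L] [DecidableEq L]
    (hL : IsLLLattice x) (y : L) :
    IncidenceAlgebra.mu ℤ (⊥ : L) y =
      ∑ g ∈ (levelTransversals x).filter (fun g => Finset.univ.sup g = y),
        ∏ i, (if g i = ⊥ then (1 : ℤ) else -1) := by
  induction y using WellFoundedLT.induction with
  | ind w ih =>
  have hmu := IncidenceAlgebra.sum_Icc_mu_right (𝕜 := ℤ) (⊥ : L) w
  have hsum := hL.sum_levelTransversals_le w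
  rw [← Finset.sum_fiberwise_of_maps_to (t := Finset.Icc ⊥ w)
    (g := fun g : Fin n → L => Finset.univ.sup g)
    (fun g hg => Finset.mem_Icc.2 ⟨bot_le, (Finset.mem_filter.1 hg).2⟩)] at hsum
  have hfib : ∀ y ∈ Finset.Icc ⊥ w,
      ((levelTransversals x).filter (fun g => Finset.univ.sup g ≤ w)).filter
        (fun g => Finset.univ.sup g = y) =
      (levelTransversals x).filter (fun g => Finset.univ.sup g = y) := fun y hy => by
    ext g
    simp only [Finset.mem_filter]
    constructor
    · tauto
    · rintro ⟨hg, rfl⟩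
      exact ⟨⟨hg, (Finset.mem_Icc.1 hy).2⟩, rfl⟩
  rw [Finset.sum_congr rfl fun y hy => by rw [hfib y hy]] at hsum
  have hw : w ∈ Finset.Icc ⊥ w := Finset.mem_Icc.2 ⟨bot_le, le_rfl⟩
  rw [← Finset.add_sum_erase _ _ hw] at hmu hsum
  have hrest : ∀ y ∈ (Finset.Icc ⊥ w).erase w, IncidenceAlgebra.mu ℤ (⊥ : L) y = _ :=
    fun y hy => ih y (lt_of_le_of_ne (Finset.mem_Icc.1 (Finset.mem_of_mem_erase hy)).2
      (Finset.ne_of_mem_erase hy))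
  rw [Finset.sum_congr rfl hrest] at hmu
  have hif : (if (⊥ : L) = w then (1 : ℤ) else 0) = if w = ⊥ then 1 else 0 := by
    simp only [eq_comm]
  rw [hif] at hmu
  exact add_right_cancel (hmu.trans (by convert hsum.symm))

end

/-! ### The characteristic polynomial -/

theorem theorem16 {L : Type*} [Lattice L] [BoundedOrder L] [Fintype L] [LocallyFiniteOrder L]
    [DecidableEq L] {n : ℕ} (x : Fin (n + 1) → L) (hL : IsLLLattice x) :
    charPolynomial (levelRank x) =
      ∏ i ∈ Finset.univ.filter (fun i : Fin n => (atomLevel x i).Nonempty),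
        (X - C ((atomLevel x i).card : ℤ)) := by
  classical
  -- Leaving level `i` out contributes `X`, except that an empty level contributes `1`.
  let v : Fin n → L → ℤ[X] := fun i a =>
    C (if a = ⊥ then (1 : ℤ) else -1) * if (atomLevel x i).Nonempty ∧ a = ⊥ then X else 1
  have hright : ∏ i ∈ Finset.univ.filter (fun i : Fin n => (atomLevel x i).Nonempty),
      (X - C ((atomLevel x i).card : ℤ)) = ∏ i, ∑ a ∈ insert ⊥ (atomLevel x i), v i a := by
    rw [Finset.prod_filter]
    refine Finset.prod_congr rfl fun i _ => ?_
    have hv : ∀ a ∈ atomLevel x i, v i a = -1 := fun a ha => by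
      have : a ≠ ⊥ := fun h => bot_notMem_atomLevel (x := x) i (h ▸ ha)
      simp [v, this]
    rw [Finset.sum_insert (bot_notMem_atomLevel i), Finset.sum_congr rfl hv]
    split_ifs with h
    · simp [v, h, sub_eq_add_neg]
    · simp [v, Finset.not_nonempty_iff_eq_empty.1 h]
  have hleft : charPolynomial (levelRank x) = ∑ g ∈ levelTransversals x, ∏ i, v i (g i) := by
    unfold charPolynomial
    rw [← Finset.sum_fiberwise_of_maps_to (t := Finset.univ)
      (g := fun g : Fin n → L => Finset.univ.sup g) (fun g _ => Finset.mem_univ _)]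
    refine Finset.sum_congr rfl fun y _ => ?_
    rw [hL.mu_bot_eq_sum_levelTransversals, map_sum, Finset.sum_mul]
    refine Finset.sum_congr (by congr!) fun g hg => ?_
    obtain ⟨hg', rfl⟩ := Finset.mem_filter.1 hg
    rw [hL.levelRank_top_sub hg']
    simp only [v]
    rw [Finset.prod_mul_distrib, ← map_prod, ← Finset.prod_filter, Finset.prod_const]
    congr!
  rw [hleft, hright, Finset.prod_univ_sum]
  refine Finset.sum_congr ?_ fun _ _ => rfl
  unfold levelTransversals
  congr!
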